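/- Equip $[0,1]\times\{0,1\}$ with its Borel $\sigma$-algebra. For a Borel measurable metric $d:[0,1]^2\to[0,\infty]$ (the value $+\infty$ is allowed) and a probability distribution $\mathcal D$ of pairs $(f,y)\in[0,1]\times\{0,1\}$, define the weak calibration error $$\mathrm{wCE}_d(\mathcal D)=\sup_{w}\ \mathbb E_{(f,y)\sim\mathcal D}\big[(f-y)\,w(f)\big],$$ where the supremum is over all measurable $w:[0,1]\to[-1,1]$ with $|w(u)-w(v)|\le d(u,v)$ for all $u,v\in[0,1]$. Define the distance to calibration $$\underline{\mathrm{dCE}}_d(\mathcal D)=\inf_{\mathcal D'}\ \inf_{\gamma}\ \mathbb E_{((f_1,y_1),(f_2,y_2))\sim\gamma}\big[d(f_1,f_2)+|y_1-y_2|\big],$$ where $\mathcal D'$ ranges over the perfectly calibrated probability distributions on $[0,1]\times\{0,1\}$, i.e. those with $\mathbb E_{\mathcal D'}[y\mid f]=f$ almost surely, and $\gamma$ over the couplings of $\mathcal D$ and $\mathcal D'$; that is, $\underline{\mathrm{dCE}}_d(\mathcal D)$ is the Wasserstein-1 distance from $\mathcal D$ to the set of perfectly calibrated distributions for the metric $d(f_1,f_2)+|y_1-y_2|$.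 **Theorem.** For every $c>0$ there are constants $C_1,C_2>0$, depending only on $c$, such that for every Borel measurable metric $d:[0,1]^2\to[0,\infty]$ with $d(u,v)\ge c\,|u-v|$ for all $u,v\in[0,1]$, and every probability distribution $\mathcal D$ on $[0,1]\times\{0,1\}$, $$C_1\,\underline{\mathrm{dCE}}_d(\mathcal D)\ \le\ \mathrm{wCE}_d(\mathcal D)\ \le\ C_2\,\underline{\mathrm{dCE}}_d(\mathcal D).$$ -/

import Mathlib

open MeasureTheory
open scoped ENNReal NNReal unitInterval

noncomputable section

namespace Calibration

/-- The space `[0,1] × {0,1}` of pairs (prediction, outcome), with its product Borel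
sigma-algebra. The outcome `1` is `true` and the outcome `0` is `false`. -/
abbrev Pred : Type := I × Bool

/-- The outcome as a real number, `0` or `1`. -/
def outcome (y : Bool) : ℝ := if y then 1 else 0

/-- `d` is a metric with values in `[0, ∞]`. -/
structure IsExtMetric {X : Type*} (d : X → X → ℝ≥0∞) : Prop where
  eq_zero_iff : ∀ u v, d u v = 0 ↔ u = v
  symm : ∀ u v, d u v = d v u
  triangle : ∀ u v w, d u w ≤ d u v + d v w

/-- The metric `d(f₁, f₂) + |y₁ - y₂|` on `[0,1] × {0,1}`. -/
def predDist (d : I → I → ℝ≥0∞) (p q : Pred) : ℝ≥0∞ :=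
  d p.1 q.1 + ENNReal.ofReal |outcome p.2 - outcome q.2|

/-- `γ` is a coupling of `μ` and `ν`: its two marginals are `μ` and `ν`. -/
def IsCoupling {X : Type*} [MeasurableSpace X] (μ ν : Measure X) (γ : Measure (X × X)) : Prop :=
  γ.map Prod.fst = μ ∧ γ.map Prod.snd = ν

/-- The Wasserstein distance `W₁(μ, ν)` for the metric `δ`. -/
def wasserstein {X : Type*} [MeasurableSpace X] (δ : X → X → ℝ≥0∞) (μ ν : Measure X) : ℝ≥0∞ :=
  ⨅ (γ : Measure (X × X)) (_ : IsCoupling μ ν γ), ∫⁻ p, δ p.1 p.2 ∂γ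

/-- Perfect calibration: `E[y | f] = f` almost surely. -/
def IsPerfectlyCalibrated (D : Measure Pred) : Prop :=
  D[fun z => outcome z.2 | MeasurableSpace.comap Prod.fst inferInstance]
    =ᵐ[D] fun z => (z.1 : ℝ)

/-- The distance to calibration: the Wasserstein distance, for the metric
`d(f₁, f₂) + |y₁ - y₂|`, from `D` to the set of perfectly calibrated distributions. -/
def dCE (d : I → I → ℝ≥0∞) (D : Measure Pred) : ℝ≥0∞ :=
  ⨅ (D' : Measure Pred) (_ : IsProbabilityMeasure D') (_ : IsPerfectlyCalibrated D'),
    wasserstein (predDist d) D D'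

/-- The (measurable) functions `w : [0,1] → [-1,1]` that are `1`-Lipschitz with respect
to `d`. -/
def lipschitzTests (d : I → I → ℝ≥0∞) : Set (I → ℝ) :=
  {w | Measurable w ∧ (∀ u, w u ∈ Set.Icc (-1 : ℝ) 1) ∧
    ∀ u v, ENNReal.ofReal |w u - w v| ≤ d u v}

/-- The weak calibration error `sup_w E[(f - y) w(f)]`. The supremum is over a nonempty
bounded set of reals for a probability distribution `D`, as `w = 0` is admissible and
`|(f - y) w(f)| ≤ 1`. -/
def wCE (d : I → I → ℝ≥0∞) (D : Measure Pred) : ℝ :=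
  sSup {r | ∃ w ∈ lipschitzTests d, r = ∫ z, ((z.1 : ℝ) - outcome z.2) * w z.1 ∂D}

end Calibration

end

/-!
The upper bound on `wCE` needs no duality. For a test `w`, the function `(f - y) w(f)` is
Lipschitz for the metric `d(f₁, f₂) + |y₁ - y₂|` with constant `1 + 1/c`, because
`c |f₁ - f₂| ≤ d(f₁, f₂)`; its mean vanishes on calibrated distributions. Hence `C₂ = 1 + 1/c`.

For the lower bound, a calibrated distribution is obtained from `D` by flipping the label `y` of
a prediction `f` with probability `|f - y|` (`recalibrate`). The flipped part of `D` is a measure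
`κ ≤ D` (`flipMass`) with `∫ g(f) (1 - 2y) dκ = ∫ g(f) (f - y) dD`. Flipping labels costs the
mass of `κ`, which can be saved by transport: instead of flipping the labels of mass at `(u, 0)`
and of equal mass at `(v, 1)`, the two are exchanged, at cost `2 d(u, v)` per unit, with the same
outcome (`wasserstein_recalibrate_le`). So `dCE` is at most twice the value of a partial transport
problem between the label-`0` part and the label-`1` part of `κ`, in which moved mass costs
`min d 2` and unmoved mass costs `1`. By Kantorovich duality that value is the supremum of
`∫ w(f) (1 - 2y) dκ` over tests `w`, which is `wCE`. Hence `C₁ = 1/2`.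

The duality has to be proved for a metric that is only Borel measurable, in two steps.

* A near-optimal plan exists for every Borel reward `2 - min d 2`
  (`exists_measure_of_forall_isCover`). Its subgraph is a continuous image of `ℕ → ℕ`. The dual
  value, the infimum of `∫ Φ` over the potentials `Φ` that cover a set, is a Choquet capacity:
  it is continuous along increasing sequences of arbitrary sets (`IsCover.exists_iUnion`, since
  covers form bounded convex sets in `L²`), so it is nearly attained on a compact box
  `∏ [0, nᵢ]` of `ℕ → ℕ`. On the box the duality is the Hahn–Banach theorem together with the
  Riesz–Markov–Kakutani theorem.
* A pair of dual potentials is dominated by one Borel Lipschitz function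
  (`exists_measurable_lipschitz_between`). Inf-convolutions are Lipschitz but only have analytic
  sublevel sets; alternating them with the insertion of a Borel function, which is possible by
  Lusin's separation theorem, gives in the limit a function that is both Borel and Lipschitz.
-/

namespace Calibration

open Filter Topology

/-! ### Convexity and the cover capacity -/

/-- A decreasing sequence of bounded convex sets in an inner product space has a Cauchy selection:
by the parallelogram law, points of nearly minimal norm are close to each other. -/
theorem exists_cauchySeq_mem_of_antitone_convex {E : Type*} [NormedAddCommGroup E]
    [InnerProductSpace ℝ E] {C : ℕ → Set E} (hC : Antitone C) (hconv : ∀ n, Convex ℝ (C n))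
    (hne : ∀ n, (C n).Nonempty) {R : ℝ} (hR : ∀ n, ∀ x ∈ C n, ‖x‖ ≤ R) :
    ∃ x : ℕ → E, (∀ n, x n ∈ C n) ∧ CauchySeq x := by
  let N : E → ℝ := fun x => ‖x‖ ^ 2
  let q : ℕ → ℝ := fun n => sInf (N '' C n)
  have hbdd : ∀ n, BddBelow (N '' C n) := fun n =>
    ⟨0, by rintro _ ⟨x, -, rfl⟩; exact sq_nonneg _⟩
  have hq_le : ∀ n, ∀ x ∈ C n, q n ≤ ‖x‖ ^ 2 := fun n x hx =>
    csInf_le (hbdd n) ⟨x, hx, rfl⟩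
  have hq_mono : Monotone q := fun n m hnm =>
    csInf_le_csInf (hbdd n) ((hne m).image N) (Set.image_mono (hC hnm))
  have hq_bdd : BddAbove (Set.range q) := by
    refine ⟨R ^ 2, ?_⟩
    rintro _ ⟨n, rfl⟩
    obtain ⟨x, hx⟩ := hne n
    exact (hq_le n x hx).trans (pow_le_pow_left₀ (norm_nonneg _) (hR n x hx) 2)
  let ε : ℕ → ℝ := fun n => 1 / ((n : ℝ) + 1)
  have hε : ∀ n, 0 < ε n := fun n => Nat.one_div_pos_of_nat
  have hε_anti : Antitone ε := fun n m hnm => Nat.one_div_le_one_div hnm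
  have hx : ∀ n, ∃ x ∈ C n, ‖x‖ ^ 2 < q n + ε n := by
    intro n
    obtain ⟨_, ⟨x, hx, rfl⟩, hlt⟩ :=
      exists_lt_of_csInf_lt ((hne n).image N) (lt_add_of_pos_right (q n) (hε n))
    exact ⟨x, hx, hlt⟩
  choose x hxC hxq using hx
  refine ⟨x, hxC, ?_⟩
  let L : ℝ := ⨆ n, q n
  have hqL : ∀ n, q n ≤ L := le_ciSup hq_bdd
  -- the midpoint of `x n` and `x m` lies in `C n`, so its norm is at least `√(q n)`
  have key : ∀ n m, n ≤ m → ‖x n - x m‖ ^ 2 ≤ 2 * (L - q n) + 4 * ε n := by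
    intro n m hnm
    have hmid : (1 / 2 : ℝ) • x n + (1 / 2 : ℝ) • x m ∈ C n :=
      hconv n (hxC n) (hC hnm (hxC m)) (by norm_num) (by norm_num) (by norm_num)
    have h1 := hq_le n _ hmid
    rw [← smul_add, norm_smul, mul_pow] at h1
    have h2 := parallelogram_law_with_norm ℝ (x n) (x m)
    have h3 := hxq n
    have h4 := hxq m
    have h5 := hε_anti hnm
    have h6 := hqL m
    norm_num at h1
    linarith
  have hlim : Tendsto (fun n => √(2 * (L - q n) + 4 * ε n)) atTop (𝓝 0) := by
    have h1 : Tendsto q atTop (𝓝 L) := tendsto_atTop_ciSup hq_mono hq_bdd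
    have h2 : Tendsto ε atTop (𝓝 0) := tendsto_one_div_add_atTop_nhds_zero_nat
    have h3 := (((tendsto_const_nhds (x := L)).sub h1).const_mul 2).add (h2.const_mul 4)
    simpa using h3.sqrt
  refine cauchySeq_of_le_tendsto_0 _ (fun n m k hkn hkm => ?_) hlim
  have mono : ∀ n, k ≤ n → 2 * (L - q n) + 4 * ε n ≤ 2 * (L - q k) + 4 * ε k := fun n hn => by
    have := hq_mono hn
    have := hε_anti hn
    linarith
  apply Real.le_sqrt_of_sq_le
  rcases le_total n m with h | h
  · rw [dist_eq_norm]; exact (key n m h).trans (mono n hkn)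
  · rw [dist_comm, dist_eq_norm]; exact (key m n h).trans (mono m hkm)

/-- `Φ : Y → [0, M]` is a measurable potential that dominates `c` on `A` along the two maps
`α, β : Z → Y`. The infimum of `∫ Φ` over all covers of `A` is a capacity on `Z`, and is the
dual value of a transport problem with reward `c`. -/
structure IsCover {Z Y : Type*} [MeasurableSpace Y] (α β : Z → Y) (c : Z → ℝ) (M : ℝ)
    (A : Set Z) (Φ : Y → ℝ) : Prop where
  measurable : Measurable Φ
  nonneg : ∀ y, 0 ≤ Φ y
  le : ∀ y, Φ y ≤ M
  cover : ∀ z ∈ A, c z ≤ Φ (α z) + Φ (β z)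

namespace IsCover

variable {Z Y : Type*} [MeasurableSpace Y] {α β : Z → Y} {c : Z → ℝ} {M : ℝ} {A B : Set Z}
  {Φ Ψ : Y → ℝ}

theorem mono (h : IsCover α β c M B Φ) (hAB : A ⊆ B) : IsCover α β c M A Φ :=
  ⟨h.1, h.2, h.3, fun z hz => h.4 z (hAB hz)⟩

theorem norm_le (h : IsCover α β c M A Φ) (y : Y) : ‖Φ y‖ ≤ M := by
  rw [Real.norm_of_nonneg (h.nonneg y)]; exact h.le y

theorem memLp (h : IsCover α β c M A Φ) (κ : Measure Y) [IsFiniteMeasure κ] (p : ℝ≥0∞) :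
    MemLp Φ p κ :=
  MemLp.of_bound h.measurable.aestronglyMeasurable M (ae_of_all _ h.norm_le)

theorem integrable (h : IsCover α β c M A Φ) (κ : Measure Y) [IsFiniteMeasure κ] :
    Integrable Φ κ := memLp_one_iff_integrable.1 (h.memLp κ 1)

theorem convexComb (hΦ : IsCover α β c M A Φ) (hΨ : IsCover α β c M A Ψ) {a b : ℝ} (ha : 0 ≤ a)
    (hb : 0 ≤ b) (hab : a + b = 1) : IsCover α β c M A (fun y => a * Φ y + b * Ψ y) where
  measurable := (hΦ.measurable.const_mul a).add (hΨ.measurable.const_mul b)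
  nonneg y := add_nonneg (mul_nonneg ha (hΦ.nonneg y)) (mul_nonneg hb (hΨ.nonneg y))
  le y := by
    have h1 := mul_le_mul_of_nonneg_left (hΦ.le y) ha
    have h2 := mul_le_mul_of_nonneg_left (hΨ.le y) hb
    calc a * Φ y + b * Ψ y ≤ a * M + b * M := add_le_add h1 h2
      _ = M := by rw [← add_mul, hab, one_mul]
  cover z hz := by
    have h1 := mul_le_mul_of_nonneg_left (hΦ.cover z hz) ha
    have h2 := mul_le_mul_of_nonneg_left (hΨ.cover z hz) hb
    calc c z = a * c z + b * c z := by rw [← add_mul, hab, one_mul]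
      _ ≤ a * (Φ (α z) + Φ (β z)) + b * (Ψ (α z) + Ψ (β z)) := add_le_add h1 h2
      _ = _ := by ring

/-- A pointwise upper limit of covers of increasing sets covers their union: the upper limit
is subadditive. -/
theorem limsup {A : ℕ → Set Z} (hA : Monotone A) {u : ℕ → Y → ℝ}
    (hu : ∀ n, IsCover α β c M (A n) (u n)) :
    IsCover α β c M (⋃ n, A n) (fun y => limsup (fun n => u n y) atTop) := by
  have hle : ∀ y, IsBoundedUnder (· ≤ ·) atTop (fun n => u n y) := fun y =>
    isBoundedUnder_of ⟨M, fun n => (hu n).le y⟩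
  have hge : ∀ y, IsBoundedUnder (· ≥ ·) atTop (fun n => u n y) := fun y =>
    isBoundedUnder_of ⟨0, fun n => (hu n).nonneg y⟩
  refine ⟨Measurable.limsup fun n => (hu n).measurable, fun y => ?_, fun y => ?_, fun z hz => ?_⟩
  · exact le_limsup_of_frequently_le (Frequently.of_forall fun n => (hu n).nonneg y) (hle y)
  · exact limsup_le_of_le (hge y).isCoboundedUnder_le (Eventually.of_forall fun n => (hu n).le y)
  · obtain ⟨n₀, hn₀⟩ := Set.mem_iUnion.1 hz
    have h1 : ∃ᶠ n in atTop, c z ≤ ((fun n => u n (α z)) + fun n => u n (β z)) n :=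
      ((eventually_ge_atTop n₀).mono fun n hn => (hu n).cover z (hA hn hn₀)).frequently
    refine (le_limsup_of_frequently_le h1 ?_).trans
      (limsup_add_le (hge _) (hle _) (hge _).isCoboundedUnder_le (hle _))
    exact isBoundedUnder_of ⟨M + M, fun n => add_le_add ((hu n).le _) ((hu n).le _)⟩

/-- The cover capacity is continuous along increasing sequences of arbitrary sets. -/
theorem exists_iUnion (κ : Measure Y) [IsFiniteMeasure κ] {A : ℕ → Set Z} (hA : Monotone A)
    {s : ℝ} (h : ∀ n, ∃ Φ, IsCover α β c M (A n) Φ ∧ ∫ y, Φ y ∂κ ≤ s) :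
    ∃ Φ, IsCover α β c M (⋃ n, A n) Φ ∧ ∫ y, Φ y ∂κ ≤ s := by
  let C : ℕ → Set (Lp ℝ 2 κ) := fun n =>
    {x | ∃ Φ, IsCover α β c M (A n) Φ ∧ ∫ y, Φ y ∂κ ≤ s ∧ x =ᵐ[κ] Φ}
  have hC : Antitone C := by
    rintro n m hnm x ⟨Φ, h1, h2⟩
    exact ⟨Φ, h1.mono (hA hnm), h2⟩
  have hconv : ∀ n, Convex ℝ (C n) := by
    rintro n x ⟨Φ, h1, h2, h3⟩ x' ⟨Ψ, h1', h2', h3'⟩ a b ha hb hab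
    refine ⟨_, h1.convexComb h1' ha hb hab, ?_, ?_⟩
    · rw [integral_add ((h1.integrable κ).const_mul a) ((h1'.integrable κ).const_mul b),
        integral_const_mul, integral_const_mul]
      calc _ ≤ a * s + b * s := add_le_add (mul_le_mul_of_nonneg_left h2 ha)
              (mul_le_mul_of_nonneg_left h2' hb)
        _ = s := by rw [← add_mul, hab, one_mul]
    · filter_upwards [Lp.coeFn_add (a • x) (b • x'), Lp.coeFn_smul a x, Lp.coeFn_smul b x', h3, h3']
        with y e1 e2 e3 e4 e5
      rw [e1, Pi.add_apply, e2, e3, Pi.smul_apply, Pi.smul_apply, e4, e5]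
      rfl
  have hne : ∀ n, (C n).Nonempty := fun n => by
    obtain ⟨Φ, h1, h2⟩ := h n
    exact ⟨(h1.memLp κ 2).toLp Φ, Φ, h1, h2, MemLp.coeFn_toLp _⟩
  obtain ⟨x, hxC, hx⟩ := exists_cauchySeq_mem_of_antitone_convex hC hconv hne
    (R := (measureUnivNNReal κ : ℝ) ^ (2 : ℝ≥0∞).toReal⁻¹ * |M|) (by
      rintro n x ⟨Φ, h1, -, h3⟩
      refine Lp.norm_le_of_ae_bound (abs_nonneg M) ?_
      filter_upwards [h3] with y hy
      rw [hy]
      exact (h1.norm_le y).trans (le_abs_self M))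
  obtain ⟨x₀, hx₀⟩ := cauchySeq_tendsto_of_complete hx
  obtain ⟨ns, hns, hae⟩ := (tendstoInMeasure_of_tendsto_Lp hx₀).exists_seq_tendsto_ae
  choose u hu hus hux using hxC
  have hu' : ∀ k, IsCover α β c M (A k) (u (ns k)) := fun k => (hu (ns k)).mono (hA (hns.id_le k))
  refine ⟨_, limsup hA hu', ?_⟩
  have hlim : ∀ᵐ y ∂κ, Tendsto (fun k => u (ns k) y) atTop
      (𝓝 (Filter.limsup (fun k => u (ns k) y) atTop)) := by
    filter_upwards [hae, ae_all_iff.2 hux] with y h1 h2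
    have h3 : Tendsto (fun k => u (ns k) y) atTop (𝓝 (x₀ y)) := by simpa only [h2] using h1
    rwa [h3.limsup_eq]
  have := tendsto_integral_of_dominated_convergence (fun _ => M)
    (fun k => (hu' k).measurable.aestronglyMeasurable) (integrable_const M)
    (fun k => ae_of_all _ (hu' k).norm_le) hlim
  exact le_of_tendsto' this fun k => hus (ns k)

/-- The step that makes the cover capacity inner regular: a sequence `n` is found such that the
sets bounded by `n` in finitely many coordinates still have no cheap cover. -/
theorem exists_bound (κ : Measure Y) [IsFiniteMeasure κ] {α β : (ℕ → ℕ) → Y} {c : (ℕ → ℕ) → ℝ}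
    {M s : ℝ} (h : ∀ Φ, IsCover α β c M Set.univ Φ → s < ∫ y, Φ y ∂κ) :
    ∃ n : ℕ → ℕ, ∀ k Φ, IsCover α β c M {z | ∀ i < k, z i ≤ n i} Φ → s < ∫ y, Φ y ∂κ := by
  let P : Set (ℕ → ℕ) → Prop := fun A => ∀ Φ, IsCover α β c M A Φ → s < ∫ y, Φ y ∂κ
  have step : ∀ (k : ℕ) (A : Set (ℕ → ℕ)), P A → ∃ m, P (A ∩ {z | z k ≤ m}) := by
    intro k A hA
    by_contra! hcon
    simp only [P, not_forall, not_lt] at hcon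
    have hmono : Monotone fun m => A ∩ {z : ℕ → ℕ | z k ≤ m} := fun m m' hm z hz =>
      ⟨hz.1, le_trans hz.2 hm⟩
    obtain ⟨Φ, h1, h2⟩ := exists_iUnion (α := α) (β := β) (c := c) (M := M) κ hmono (s := s)
      (fun m => by obtain ⟨Φ, h1, h2⟩ := hcon m; exact ⟨Φ, h1, h2⟩)
    refine absurd h2 (not_le.2 (hA Φ (h1.mono fun z hz => ?_)))
    exact Set.mem_iUnion.2 ⟨z k, hz, by simp⟩
  choose! f hf using step
  let S : ℕ → Set (ℕ → ℕ) := fun k => Nat.rec Set.univ (fun k A => A ∩ {z | z k ≤ f k A}) k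
  have hS : ∀ k, P (S k) := fun k => by
    induction k with
    | zero => exact h
    | succ k ih => exact hf k (S k) ih
  refine ⟨fun k => f k (S k), fun k => ?_⟩
  suffices S k = {z | ∀ i < k, z i ≤ f i (S i)} by rw [← this]; exact hS k
  induction k with
  | zero => simp [S]
  | succ k ih =>
    have : S (k + 1) = S k ∩ {z | z k ≤ f k (S k)} := rfl
    rw [this, ih]
    ext z
    simp only [Set.mem_inter_iff, Set.mem_ofPred_eq, Nat.lt_succ_iff_lt_or_eq]
    constructor
    · rintro ⟨h1, h2⟩ i (hi | rfl)
      exacts [h1 i hi, ih ▸ h2]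
    · intro h
      exact ⟨fun i hi => h i (Or.inl hi), ih ▸ h k (Or.inr rfl)⟩

end IsCover

/-! ### Duality on compact boxes -/

/-- An open set that contains the compact box `∏ [0, nᵢ]` already contains the set of sequences
bounded by `n` in finitely many coordinates. -/
theorem exists_forall_lt_le_subset_of_isOpen {n : ℕ → ℕ} {U : Set (ℕ → ℕ)} (hU : IsOpen U)
    (hn : {z : ℕ → ℕ | ∀ i, z i ≤ n i} ⊆ U) : ∃ k, {z : ℕ → ℕ | ∀ i < k, z i ≤ n i} ⊆ U := by
  by_contra! hcon
  have hx : ∀ k, ∃ x : ℕ → ℕ, (∀ i < k, x i ≤ n i) ∧ x ∉ U := fun k => by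
    obtain ⟨x, hx, hxU⟩ := Set.not_subset.1 (hcon k)
    exact ⟨x, hx, hxU⟩
  choose x hxn hxU using hx
  have hcomp : IsCompact (Set.pi Set.univ fun i => Set.Iic (n i)) :=
    isCompact_univ_pi fun i => (Set.finite_Iic (n i)).isCompact
  obtain ⟨y, hy, φ, hφ, hlim⟩ := hcomp.tendsto_subseq (x := fun k i => min (x k i) (n i))
    (fun k i _ => Set.mem_Iic.2 (min_le_right _ _))
  -- the truncated points agree with the original ones in more and more coordinates
  have hlim' : Tendsto (fun k => x (φ k)) atTop (𝓝 y) := by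
    rw [tendsto_pi_nhds] at hlim ⊢
    intro i
    refine (hlim i).congr' ?_
    filter_upwards [eventually_gt_atTop i] with k hk
    exact min_eq_left (hxn (φ k) i (hk.trans_le (hφ.id_le k)))
  have hyU : y ∈ U := hn fun i => hy i (Set.mem_univ i)
  obtain ⟨k, hk⟩ := (hlim'.eventually (hU.mem_nhds hyU)).exists
  exact hxU _ hk

theorem measure_le_of_forall_integral_le {Y : Type*} [TopologicalSpace Y] [CompactSpace Y]
    [HasOuterApproxClosed Y] [MeasurableSpace Y] [BorelSpace Y] {ν κ : Measure Y}
    [IsFiniteMeasure ν] [IsFiniteMeasure κ] [ν.WeaklyRegular]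
    (h : ∀ Φ : C(Y, ℝ), 0 ≤ Φ → ∫ y, Φ y ∂ν ≤ ∫ y, Φ y ∂κ) : ν ≤ κ := by
  have hcl : ∀ F, IsClosed F → ν F ≤ κ F := by
    intro F hF
    refine ge_of_tendsto' (HasOuterApproxClosed.tendsto_lintegral_apprSeq hF κ) fun n => ?_
    refine (HasOuterApproxClosed.measure_le_lintegral hF ν n).trans ?_
    have h1 := h ⟨fun y => (hF.apprSeq n y : ℝ),
      NNReal.continuous_coe.comp (hF.apprSeq n).continuous⟩ (fun y => NNReal.coe_nonneg _)
    have h2 : ∀ μ : Measure Y, IsFiniteMeasure μ →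
        ∫⁻ y, (hF.apprSeq n y : ℝ≥0∞) ∂μ = ENNReal.ofReal (∫ y, (hF.apprSeq n y : ℝ) ∂μ) :=
      fun μ _ => by
        rw [← BoundedContinuousFunction.toReal_lintegral_coe_eq_integral,
          ENNReal.ofReal_toReal (BoundedContinuousFunction.lintegral_lt_top_of_nnreal μ _).ne]
    rw [h2 ν inferInstance, h2 κ inferInstance]
    exact ENNReal.ofReal_le_ofReal h1
  refine Measure.le_iff.2 fun s hs => ?_
  rw [hs.measure_eq_iSup_isClosed_of_ne_top (measure_ne_top ν s)]
  exact iSup₂_le fun F hFs => iSup_le fun hF => (hcl F hF).trans (measure_mono hFs)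

section CompactDuality

variable {K Y : Type*} [TopologicalSpace K] [TopologicalSpace Y] [MeasurableSpace Y]

/-- The dual value of the transport problem on a compact space `K` with continuous reward `u`:
the least `∫ Φ dκ` of a continuous `Φ ≥ 0` that dominates `u` along `α` and `β`. It is a
sublinear functional of `u`. -/
noncomputable def coverValue (κ : Measure Y) (α β : C(K, Y)) (u : C(K, ℝ)) : ℝ :=
  sInf {r | ∃ Φ : C(Y, ℝ), 0 ≤ Φ ∧ (∀ z, u z ≤ Φ (α z) + Φ (β z)) ∧ r = ∫ y, Φ y ∂κ}

variable {κ : Measure Y} {α β : C(K, Y)}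

theorem coverValue_le {u : C(K, ℝ)} {Φ : C(Y, ℝ)} (h0 : 0 ≤ Φ)
    (h : ∀ z, u z ≤ Φ (α z) + Φ (β z)) : coverValue κ α β u ≤ ∫ y, Φ y ∂κ :=
  csInf_le ⟨0, by rintro _ ⟨Φ, h0, -, rfl⟩; exact integral_nonneg h0⟩ ⟨Φ, h0, h, rfl⟩

theorem coverValue_nonpos {u : C(K, ℝ)} (hu : u ≤ 0) : coverValue κ α β u ≤ 0 := by
  simpa using coverValue_le (κ := κ) (α := α) (β := β) (Φ := 0) le_rfl (fun z => by simpa using hu z)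

variable [CompactSpace K]

theorem le_coverValue {u : C(K, ℝ)} {r : ℝ}
    (h : ∀ Φ : C(Y, ℝ), 0 ≤ Φ → (∀ z, u z ≤ Φ (α z) + Φ (β z)) → r ≤ ∫ y, Φ y ∂κ) :
    r ≤ coverValue κ α β u := by
  refine le_csInf ⟨_, ContinuousMap.const Y ‖u‖, fun _ => norm_nonneg u, fun z => ?_, rfl⟩ ?_
  · have := (le_abs_self _).trans (u.norm_coe_le_norm z)
    have := norm_nonneg u
    simp only [ContinuousMap.const_apply]
    linarith
  · rintro _ ⟨Φ, h0, hc, rfl⟩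
    exact h Φ h0 hc

theorem coverValue_nonneg (u : C(K, ℝ)) : 0 ≤ coverValue κ α β u :=
  le_coverValue fun _ h0 _ => integral_nonneg h0

theorem coverValue_smul {r : ℝ} (hr : 0 < r) (u : C(K, ℝ)) :
    coverValue κ α β (r • u) = r * coverValue κ α β u := by
  have key : ∀ {t : ℝ}, 0 < t → ∀ v : C(K, ℝ),
      t * coverValue κ α β v ≤ coverValue κ α β (t • v) := by
    intro t ht v
    refine le_coverValue fun Φ h0 h => ?_
    have h1 : coverValue κ α β v ≤ ∫ y, (t⁻¹ • Φ) y ∂κ := by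
      refine coverValue_le (smul_nonneg (inv_nonneg.2 ht.le) h0) fun z => ?_
      have := mul_le_mul_of_nonneg_left (h z) (inv_nonneg.2 ht.le)
      simpa [ht.ne', mul_add] using this
    simp only [ContinuousMap.smul_apply, smul_eq_mul, integral_const_mul] at h1
    calc t * coverValue κ α β v ≤ t * (t⁻¹ * ∫ y, Φ y ∂κ) := mul_le_mul_of_nonneg_left h1 ht.le
      _ = _ := by rw [mul_inv_cancel_left₀ ht.ne']
  refine le_antisymm ?_ (key hr u)
  have := mul_le_mul_of_nonneg_left (key (inv_pos.2 hr) (r • u)) hr.le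
  rwa [mul_inv_cancel_left₀ hr.ne', inv_smul_smul₀ hr.ne'] at this

variable [CompactSpace Y] [BorelSpace Y] [IsFiniteMeasure κ]

theorem integrable_of_continuousMap (κ : Measure Y) [IsFiniteMeasure κ] (Φ : C(Y, ℝ)) :
    Integrable Φ κ :=
  Φ.continuous.integrable_of_hasCompactSupport (HasCompactSupport.of_compactSpace _)

theorem coverValue_add_le (u v : C(K, ℝ)) :
    coverValue κ α β (u + v) ≤ coverValue κ α β u + coverValue κ α β v := by
  rw [← sub_le_iff_le_add]
  refine le_coverValue fun Φ hΦ hu => ?_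
  rw [sub_le_comm]
  refine le_coverValue fun Ψ hΨ hv => ?_
  rw [sub_le_iff_le_add', ← integral_add (integrable_of_continuousMap κ Φ)
    (integrable_of_continuousMap κ Ψ)]
  exact coverValue_le (Φ := Φ + Ψ) (add_nonneg hΦ hΨ) fun z => by
    have := add_le_add (hu z) (hv z)
    simp only [ContinuousMap.add_apply]
    linarith

/-- Transport duality on a compact space. A linear functional below `coverValue`, tight at `c`, is
positive because `coverValue` vanishes on nonpositive functions, and the measure that represents
it is an optimal plan. -/
theorem exists_measure_of_le_integral_continuousMap [T2Space K] [MeasurableSpace K] [BorelSpace K]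
    [TopologicalSpace.PseudoMetrizableSpace Y] (c : C(K, ℝ)) {s : ℝ}
    (h : ∀ Φ : C(Y, ℝ), 0 ≤ Φ → (∀ z, c z ≤ Φ (α z) + Φ (β z)) → s ≤ ∫ y, Φ y ∂κ) :
    ∃ ρ : Measure K, IsFiniteMeasure ρ ∧ ρ.map α + ρ.map β ≤ κ ∧ s ≤ ∫ z, c z ∂ρ := by
  rcases eq_or_ne c 0 with rfl | hc
  · refine ⟨0, inferInstance, by simp [Measure.zero_le], ?_⟩
    simpa using h 0 le_rfl (by simp)
  obtain ⟨L, hLc, hL⟩ := exists_extension_of_le_sublinear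
    (LinearPMap.mkSpanSingleton c (coverValue κ α β c) hc : C(K, ℝ) →ₗ.[ℝ] ℝ) (coverValue κ α β)
    (fun r hr u => coverValue_smul hr u) coverValue_add_le (by
      rintro ⟨x, hx⟩
      obtain ⟨t, rfl⟩ := Submodule.mem_span_singleton.1 hx
      rw [LinearPMap.mkSpanSingleton'_apply]
      simp only [RingHom.id_apply, smul_eq_mul]
      rcases lt_or_ge 0 t with ht | ht
      · exact (coverValue_smul ht c).ge
      · exact (mul_nonpos_of_nonpos_of_nonneg ht (coverValue_nonneg c)).trans (coverValue_nonneg _))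
  have hLc' : L c = coverValue κ α β c := by
    rw [← LinearPMap.mkSpanSingleton_apply ℝ ℝ hc (coverValue κ α β c)]
    exact hLc ⟨c, _⟩
  have hLpos : ∀ u : C(K, ℝ), 0 ≤ u → 0 ≤ L u := fun u hu => by
    have := (hL (-u)).trans (coverValue_nonpos (neg_nonpos.2 hu))
    rw [map_neg] at this
    linarith
  let Λ : CompactlySupportedContinuousMap K ℝ →ₚ[ℝ] ℝ := PositiveLinearMap.mk₀
    { toFun := fun u => L u.toContinuousMap
      map_add' := fun u v => L.map_add u.toContinuousMap v.toContinuousMap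
      map_smul' := fun r u => L.map_smul r u.toContinuousMap }
    (fun u hu => hLpos _ hu)
  have hint : ∀ u : C(K, ℝ), ∫ z, u z ∂(RealRMK.rieszMeasure Λ) = L u := fun u =>
    RealRMK.integral_rieszMeasure Λ (CompactlySupportedContinuousMap.continuousMapEquiv u)
  refine ⟨RealRMK.rieszMeasure Λ, inferInstance, ?_, ?_⟩
  · refine measure_le_of_forall_integral_le fun Φ hΦ => ?_
    have hmap : ∀ a : C(K, Y), ∫ y, Φ y ∂(RealRMK.rieszMeasure Λ).map a = L (Φ.comp a) := fun a => by
      rw [integral_map a.continuous.aemeasurable (Φ.continuous.aestronglyMeasurable), ← hint]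
      rfl
    rw [integral_add_measure (integrable_of_continuousMap _ Φ) (integrable_of_continuousMap _ Φ),
      hmap, hmap, ← map_add]
    exact (hL _).trans (coverValue_le hΦ fun z => le_rfl)
  · rw [hint, hLc']
    exact le_coverValue h

end CompactDuality

/-- Transport duality for the cover capacity: if no cover of the whole index space
`ℕ → ℕ` is cheap, some transport plan `ρ` has a large reward. -/
theorem exists_measure_of_forall_isCover {Y : Type*} [TopologicalSpace Y] [CompactSpace Y]
    [TopologicalSpace.PseudoMetrizableSpace Y] [MeasurableSpace Y] [BorelSpace Y]
    (κ : Measure Y) [IsFiniteMeasure κ] {α β : (ℕ → ℕ) → Y} (hα : Continuous α)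
    (hβ : Continuous β) {c : (ℕ → ℕ) → ℝ} (hc : Continuous c) {M s : ℝ}
    (hc0 : ∀ z, 0 ≤ c z) (hcM : ∀ z, c z ≤ M)
    (h : ∀ Φ, IsCover α β c M Set.univ Φ → s < ∫ y, Φ y ∂κ) :
    ∃ ρ : Measure (ℕ → ℕ), IsFiniteMeasure ρ ∧ ρ.map α + ρ.map β ≤ κ ∧ s ≤ ∫ z, c z ∂ρ := by
  obtain ⟨n, hn⟩ := IsCover.exists_bound κ h
  let K : Set (ℕ → ℕ) := {z | ∀ i, z i ≤ n i}
  have hKc : IsCompact K := by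
    have : K = Set.pi Set.univ fun i => Set.Iic (n i) := by ext z; simp [K, Pi.le_def]
    rw [this]
    exact isCompact_univ_pi fun i => (Set.finite_Iic (n i)).isCompact
  have : CompactSpace K := isCompact_iff_compactSpace.1 hKc
  obtain ⟨ρ, hρ, hle, hs⟩ := exists_measure_of_le_integral_continuousMap (κ := κ) (s := s)
    (α := ⟨fun z : K => α z, by fun_prop⟩) (β := ⟨fun z : K => β z, by fun_prop⟩)
    ⟨fun z : K => c z, by fun_prop⟩ (fun Φ hΦ hcov => by
      -- a continuous cover of `K`, enlarged by `δ`, covers a neighbourhood of `K`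
      have key : ∀ δ : ℝ, 0 < δ → s ≤ ∫ y, Φ y ∂κ + δ * κ.real Set.univ := by
        intro δ hδ
        have hU : IsOpen {z : ℕ → ℕ | c z < (Φ (α z) + δ) + (Φ (β z) + δ)} :=
          isOpen_lt hc (by fun_prop)
        obtain ⟨k, hk⟩ := exists_forall_lt_le_subset_of_isOpen (n := n) hU (fun z hz => by
          have := hcov ⟨z, hz⟩
          simp only [ContinuousMap.coe_mk] at this
          simp only [Set.mem_ofPred_eq]
          linarith)
        have hM : 0 ≤ M := (hc0 0).trans (hcM 0)
        have hcover : IsCover α β c M {z | ∀ i < k, z i ≤ n i} (fun y => min (Φ y + δ) M) := by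
          refine ⟨by fun_prop, fun y => le_min (add_nonneg (hΦ y) hδ.le) hM,
            fun y => min_le_right _ _, fun z hz => ?_⟩
          have h1 : c z < (Φ (α z) + δ) + (Φ (β z) + δ) := hk hz
          have h2 : 0 ≤ Φ (α z) := hΦ (α z)
          have h3 : 0 ≤ Φ (β z) := hΦ (β z)
          have h4 := hcM z
          rcases min_cases (Φ (α z) + δ) M with h5 | h5 <;>
            rcases min_cases (Φ (β z) + δ) M with h6 | h6 <;> linarith
        have h1 := hn k _ hcover
        have h2 : ∫ y, min (Φ y + δ) M ∂κ ≤ ∫ y, (Φ y + δ) ∂κ :=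
          integral_mono (hcover.integrable κ)
            ((integrable_of_continuousMap κ Φ).add (integrable_const δ))
            (fun y => min_le_left _ _)
        rw [integral_add (integrable_of_continuousMap κ Φ) (integrable_const δ), integral_const,
          smul_eq_mul, mul_comm] at h2
        linarith
      have hlim : Tendsto (fun δ : ℝ => ∫ y, Φ y ∂κ + δ * κ.real Set.univ) (𝓝[>] 0)
          (𝓝 (∫ y, Φ y ∂κ + 0 * κ.real Set.univ)) :=
        ((continuous_const.add (continuous_id.mul continuous_const)).tendsto 0).mono_left
          nhdsWithin_le_nhds
      have := ge_of_tendsto hlim (eventually_nhdsWithin_of_forall key)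
      simpa using this)
  refine ⟨ρ.map Subtype.val, inferInstance, ?_, ?_⟩
  · rw [Measure.map_map hα.measurable measurable_subtype_coe,
      Measure.map_map hβ.measurable measurable_subtype_coe]
    exact hle
  · rw [integral_map measurable_subtype_coe.aemeasurable hc.aestronglyMeasurable]
    exact hs

/-! ### Borel Lipschitz functions between potentials -/

/-- Insertion of a Borel function, obtained from Lusin's separation theorem applied to the level
sets. -/
theorem exists_measurable_between {X : Type*} [TopologicalSpace X] [T2Space X] [MeasurableSpace X]
    [OpensMeasurableSpace X] {g f : X → ℝ} {a b : ℝ} (hag : ∀ x, a ≤ g x)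
    (hgf : ∀ x, g x ≤ f x) (hfb : ∀ x, f x ≤ b) (hf : ∀ t, AnalyticSet {x | f x < t})
    (hg : ∀ t, AnalyticSet {x | t < g x}) :
    ∃ h : X → ℝ, Measurable h ∧ ∀ x, g x ≤ h x ∧ h x ≤ f x := by
  have hge : ∀ t, {x | t ≤ g x} = ⋂ n : ℕ, {x | t - 1 / ((n : ℝ) + 1) < g x} := by
    intro t
    ext x
    simp only [Set.mem_ofPred_eq, Set.mem_iInter]
    refine ⟨fun h n => (sub_lt_self t Nat.one_div_pos_of_nat).trans_le h, fun h => ?_⟩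
    refine le_of_forall_pos_lt_add fun ε hε => ?_
    obtain ⟨n, hn⟩ := exists_nat_one_div_lt hε
    linarith [h n]
  have hsep : ∀ q : ℚ, ∃ C : Set X, {x | f x < q} ⊆ C ∧ Disjoint {x | (q : ℝ) ≤ g x} C ∧
      MeasurableSet C := fun q => by
    refine (hf q).measurablySeparable ?_ ?_
    · rw [hge]
      exact AnalyticSet.iInter fun n => hg _
    · rw [Set.disjoint_left]
      intro x hx hx'
      simp only [Set.mem_ofPred_eq] at hx hx'
      linarith [hgf x]
  choose C hfC hgC hC using hsep
  have hlt : ∀ q x, x ∈ C q → g x < q := fun q x hx => by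
    by_contra! hcon
    exact Set.disjoint_left.1 (hgC q) hcon hx
  classical
  let F : ℚ → X → ℝ := fun q x => if x ∈ C q then (q : ℝ) else b
  have hgF : ∀ q x, g x ≤ F q x := fun q x => by
    by_cases hx : x ∈ C q
    · simpa [F, hx] using (hlt q x hx).le
    · simpa [F, hx] using (hgf x).trans (hfb x)
  refine ⟨fun x => ⨅ q, F q x, Measurable.iInf fun q =>
    Measurable.ite (hC q) measurable_const measurable_const, fun x => ⟨?_, ?_⟩⟩
  · exact le_ciInf fun q => hgF q x
  · refine le_of_forall_gt_imp_ge_of_dense fun t ht => ?_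
    obtain ⟨q, hq, hqt⟩ := exists_rat_btwn ht
    have h1 : F q x = q := if_pos (hfC q hq)
    refine (ciInf_le ⟨a, ?_⟩ q).trans (h1.le.trans hqt.le)
    rintro _ ⟨q, rfl⟩
    exact (hag x).trans (hgF q x)

/-- The inf-convolution `x ↦ inf_y (u y + e x y)`: the largest `e`-Lipschitz minorant of `u`
when `e` is a pseudometric. -/
noncomputable def infConv {X : Type*} (e : X → X → ℝ) (u : X → ℝ) (x : X) : ℝ := ⨅ y, (u y + e x y)

section InfConv

variable {X : Type*} {e : X → X → ℝ} {u : X → ℝ} {a : ℝ}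

theorem infConv_le (he0 : ∀ x y, 0 ≤ e x y) (hu : ∀ y, a ≤ u y) (x y : X) :
    infConv e u x ≤ u y + e x y := by
  refine ciInf_le ⟨a, ?_⟩ y
  rintro _ ⟨z, rfl⟩
  exact (hu z).trans (le_add_of_nonneg_right (he0 x z))

theorem le_infConv {x : X} {r : ℝ} (h : ∀ y, r ≤ u y + e x y) : r ≤ infConv e u x :=
  have : Nonempty X := ⟨x⟩
  le_ciInf h

theorem infConv_le_infConv_add (he0 : ∀ x y, 0 ≤ e x y)
    (htri : ∀ x y z, e x z ≤ e x y + e y z) (hu : ∀ y, a ≤ u y) (x x' : X) :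
    infConv e u x ≤ infConv e u x' + e x x' := by
  rw [← sub_le_iff_le_add]
  refine le_infConv fun y => ?_
  have h1 := infConv_le he0 hu x y
  have h2 := htri x x' y
  linarith

theorem analyticSet_infConv_lt [TopologicalSpace X] [PolishSpace X] [MeasurableSpace X]
    [BorelSpace X] (he : Measurable fun p : X × X => e p.1 p.2) (he0 : ∀ x y, 0 ≤ e x y)
    (hum : Measurable u) (hu : ∀ y, a ≤ u y) (t : ℝ) : AnalyticSet {x | infConv e u x < t} := by
  have h1 : {x | infConv e u x < t} = Prod.fst '' {p : X × X | u p.2 + e p.1 p.2 < t} := by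
    ext x
    simp only [Set.mem_ofPred_eq, Set.mem_image, Prod.exists, exists_and_right, exists_eq_right]
    constructor
    · intro h
      have : Nonempty X := ⟨x⟩
      exact exists_lt_of_ciInf_lt h
    · rintro ⟨y, hy⟩
      exact (infConv_le he0 hu x y).trans_lt hy
  rw [h1]
  have h2 : MeasurableSet {p : X × X | u p.2 + e p.1 p.2 < t} :=
    measurableSet_lt ((hum.comp measurable_snd).add he) measurable_const
  exact h2.analyticSet.image_of_continuous continuous_fst

/-- A pair of potentials that is feasible for the dual transport problem with cost a Borel
pseudometric `e` is dominated by a single Borel `e`-Lipschitz function. The inf-convolution of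
a potential is Lipschitz but its sublevel sets are only analytic, so that Borel insertion and
inf-convolution are alternated; the limit has both properties. -/
theorem exists_measurable_lipschitz_between [TopologicalSpace X] [PolishSpace X]
    [MeasurableSpace X] [BorelSpace X] (he : Measurable fun p : X × X => e p.1 p.2)
    (he0 : ∀ x y, 0 ≤ e x y) (hself : ∀ x, e x x = 0) (hsymm : ∀ x y, e x y = e y x)
    (htri : ∀ x y z, e x z ≤ e x y + e y z) {v : X → ℝ} {b : ℝ} (hum : Measurable u)
    (hvm : Measurable v) (hu : ∀ x, |u x| ≤ b) (hv : ∀ x, |v x| ≤ b)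
    (huv : ∀ x y, 0 ≤ v x + u y + e x y) :
    ∃ h : X → ℝ, Measurable h ∧ (∀ x, -v x ≤ h x ∧ h x ≤ u x) ∧ ∀ x y, h x ≤ h y + e x y := by
  have hu' : ∀ x, -b ≤ u x := fun x => (abs_le.1 (hu x)).1
  have hv' : ∀ x, -b ≤ v x := fun x => (abs_le.1 (hv x)).1
  let g : X → ℝ := fun x => -infConv e v x
  have hvg : ∀ x, -v x ≤ g x := fun x => by
    have := infConv_le he0 hv' x x
    rw [hself, add_zero] at this
    exact neg_le_neg this
  have hbg : ∀ x, -b ≤ g x := fun x => by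
    have := (abs_le.1 (hv x)).2
    linarith [hvg x]
  have hglip : ∀ x y, g x ≤ g y + e x y := fun x y => by
    have := infConv_le_infConv_add he0 htri hv' y x
    rw [hsymm y x] at this
    simp only [g]
    linarith
  have hgu : ∀ x, g x ≤ u x := fun x => by
    have : -u x ≤ infConv e v x := le_infConv fun y => by
      have := huv y x
      rw [hsymm y x] at this
      linarith
    simp only [g]
    linarith
  have hgan : ∀ t, AnalyticSet {x | t < g x} := fun t => by
    have : {x | t < g x} = {x | infConv e v x < -t} := by
      ext x
      simp only [g, Set.mem_ofPred_eq]
      exact lt_neg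
    rw [this]
    exact analyticSet_infConv_lt he he0 hvm hv' _
  let S := {h : X → ℝ // Measurable h ∧ ∀ x, g x ≤ h x ∧ h x ≤ u x}
  have hS : ∀ h : S, ∀ x, -b ≤ h.1 x := fun h x => (hbg x).trans (h.2.2 x).1
  have hle : ∀ h : S, ∀ x, infConv e h.1 x ≤ u x := fun h x => by
    have := infConv_le he0 (hS h) x x
    rw [hself, add_zero] at this
    exact this.trans (h.2.2 x).2
  have step : ∀ h : S, ∃ h' : S, ∀ x, h'.1 x ≤ infConv e h.1 x := by
    intro h
    obtain ⟨h', hm, hb⟩ := exists_measurable_between (f := infConv e h.1) (b := b) hbg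
      (fun x => le_infConv fun y =>
        (hglip x y).trans (add_le_add_left (h.2.2 y).1 _))
      (fun x => (hle h x).trans (abs_le.1 (hu x)).2)
      (analyticSet_infConv_lt he he0 h.2.1 (hS h)) hgan
    exact ⟨⟨h', hm, fun x => ⟨(hb x).1, (hb x).2.trans (hle h x)⟩⟩, fun x => (hb x).2⟩
  choose next hnext using step
  let H : ℕ → S := fun n => Nat.rec ⟨u, hum, fun x => ⟨hgu x, le_rfl⟩⟩ (fun _ h => next h) n
  have hbdd : ∀ x, BddBelow (Set.range fun n => (H n).1 x) := fun x =>
    ⟨-b, by rintro _ ⟨n, rfl⟩; exact hS (H n) x⟩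
  refine ⟨fun x => ⨅ n, (H n).1 x, Measurable.iInf fun n => (H n).2.1, fun x => ⟨?_, ?_⟩,
    fun x y => ?_⟩
  · exact (hvg x).trans (le_ciInf fun n => ((H n).2.2 x).1)
  · exact (ciInf_le (hbdd x) 0).trans ((H 0).2.2 x).2
  · rw [← sub_le_iff_le_add]
    refine le_ciInf fun n => ?_
    have h1 : (⨅ n, (H n).1 x) ≤ (H (n + 1)).1 x := ciInf_le (hbdd x) (n + 1)
    have h2 : (H (n + 1)).1 x ≤ infConv e (H n).1 x := hnext (H n) x
    have h3 := infConv_le he0 (hS (H n)) x y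
    linarith

end InfConv

/-! ### Recalibration by flipping labels -/

theorem measurable_outcome : Measurable outcome := measurable_of_countable _

/-- The residual `f - y` of a prediction. -/
def residual (z : Pred) : ℝ := (z.1 : ℝ) - outcome z.2

/-- The sign of the residual, `1` for the outcome `0` and `-1` for the outcome `1`. -/
def residualSign (z : Pred) : ℝ := 1 - 2 * outcome z.2

theorem measurable_residual : Measurable residual :=
  (measurable_subtype_coe.comp measurable_fst).sub (measurable_outcome.comp measurable_snd)

theorem abs_residual_le_one (z : Pred) : |residual z| ≤ 1 := by
  obtain ⟨⟨x, h0, h1⟩, _ | _⟩ := z <;> simp only [residual, outcome, abs_le] <;> norm_num <;>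
    constructor <;> linarith

theorem abs_residual_mul_sign (z : Pred) : |residual z| * residualSign z = residual z := by
  obtain ⟨⟨x, h0, h1⟩, _ | _⟩ := z <;> simp only [residual, residualSign, outcome]
  · norm_num
    exact h0
  · norm_num
    rw [abs_of_nonpos (by linarith)]
    ring

/-- The part of `D` whose labels are flipped by the recalibration of `D`: the label `y` of a
prediction `f` is flipped with probability `|f - y|`, so that the new label is `1` with
probability `f`. Weighted by the sign of the residual, its first marginal is the signed measure
with density `E[f - y | f]` with respect to the first marginal of `D`. -/
noncomputable def flipMass (D : Measure Pred) : Measure Pred :=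
  D.withDensity fun z => ENNReal.ofReal |residual z|

theorem flipMass_le (D : Measure Pred) : flipMass D ≤ D := by
  conv_rhs => rw [← withDensity_one (μ := D)]
  exact withDensity_mono (ae_of_all _ fun z => by
    simpa using ENNReal.ofReal_le_ofReal (abs_residual_le_one z))

instance (D : Measure Pred) [IsFiniteMeasure D] : IsFiniteMeasure (flipMass D) :=
  isFiniteMeasure_of_le D (flipMass_le D)

theorem integral_mul_residualSign (D : Measure Pred) (g : Pred → ℝ) :
    ∫ z, g z * residualSign z ∂flipMass D = ∫ z, g z * residual z ∂D := by
  rw [flipMass, integral_withDensity_eq_integral_toReal_smul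
    (f := fun z => ENNReal.ofReal |residual z|) measurable_residual.abs.ennreal_ofReal
    (by simp)]
  refine integral_congr_ae (ae_of_all _ fun z => ?_)
  simp only [smul_eq_mul, ENNReal.toReal_ofReal (abs_nonneg _)]
  rw [mul_left_comm, abs_residual_mul_sign]

/-- Flip the label of a prediction. -/
def flip (z : Pred) : Pred := (z.1, !z.2)

theorem measurable_flip : Measurable flip :=
  measurable_fst.prodMk ((measurable_of_countable Bool.not).comp measurable_snd)

theorem residual_flip (z : Pred) : residual (flip z) = residual z - residualSign z := by
  obtain ⟨x, _ | _⟩ := z <;> simp [residual, residualSign, flip, outcome]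
  ring

/-- The distribution of predictions with the first marginal of `D` whose label is `1` with
conditional probability `f`. -/
noncomputable def recalibrate (D : Measure Pred) : Measure Pred :=
  (D - flipMass D) + (flipMass D).map flip

theorem integrable_of_abs_le {X : Type*} [MeasurableSpace X] (μ : Measure X) [IsFiniteMeasure μ]
    {f : X → ℝ} {b : ℝ} (hf : Measurable f) (hb : ∀ x, |f x| ≤ b) : Integrable f μ :=
  Integrable.of_bound hf.aestronglyMeasurable b (ae_of_all _ hb)

theorem isPerfectlyCalibrated_of_forall (D : Measure Pred) [IsFiniteMeasure D]
    (h : ∀ B : Set I, MeasurableSet B → ∫ z in Prod.fst ⁻¹' B, residual z ∂D = 0) :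
    IsPerfectlyCalibrated D := by
  have hm : MeasurableSpace.comap (Prod.fst : Pred → I) inferInstance ≤
      (inferInstance : MeasurableSpace Pred) :=
    measurable_fst.comap_le
  have hf : Measurable fun z : Pred => (z.1 : ℝ) := measurable_subtype_coe.comp measurable_fst
  have hy : Measurable fun z : Pred => outcome z.2 := measurable_outcome.comp measurable_snd
  have hfi : Integrable (fun z : Pred => (z.1 : ℝ)) D :=
    integrable_of_abs_le (b := 1) D hf fun z => abs_le.2 ⟨by linarith [z.1.2.1], z.1.2.2⟩
  have hyi : Integrable (fun z : Pred => outcome z.2) D :=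
    integrable_of_abs_le (b := 1) D hy fun z => by
      obtain ⟨x, _ | _⟩ := z <;> simp [outcome]
  refine (ae_eq_condExp_of_forall_setIntegral_eq hm hyi (fun s _ _ => hfi.integrableOn)
    ?_ ?_).symm
  · rintro _ ⟨B, hB, rfl⟩ -
    have h1 := h B hB
    simp only [residual] at h1
    rw [integral_sub hfi.integrableOn hyi.integrableOn] at h1
    linarith
  · exact (measurable_subtype_coe.comp
      (comap_measurable (Prod.fst : Pred → I))).stronglyMeasurable.aestronglyMeasurable

theorem isPerfectlyCalibrated_recalibrate (D : Measure Pred) [IsFiniteMeasure D] :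
    IsPerfectlyCalibrated (recalibrate D) := by
  have : IsFiniteMeasure (recalibrate D) := by unfold recalibrate; infer_instance
  refine isPerfectlyCalibrated_of_forall _ fun B hB => ?_
  have hB' : MeasurableSet (Prod.fst ⁻¹' B : Set Pred) := measurable_fst hB
  let g : Pred → ℝ := (Prod.fst ⁻¹' B : Set Pred).indicator 1
  have hg : Measurable g := measurable_one.indicator hB'
  have hg1 : ∀ z, |g z| ≤ 1 := fun z => by
    by_cases hz : z ∈ (Prod.fst ⁻¹' B : Set Pred) <;> simp [g, hz]
  have hgf : ∀ z, g (flip z) = g z := fun z => by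
    by_cases hz : z.1 ∈ B <;> simp [g, flip, hz]
  have hgr : Measurable fun z => g z * residual z := hg.mul measurable_residual
  have hgr1 : ∀ z, |g z * residual z| ≤ 1 := fun z => by
    rw [abs_mul]
    exact mul_le_one₀ (hg1 z) (abs_nonneg _) (abs_residual_le_one z)
  have hs1 : ∀ z, |g z * residualSign z| ≤ 1 := fun z => by
    rw [abs_mul]
    refine mul_le_one₀ (hg1 z) (abs_nonneg _) ?_
    obtain ⟨x, _ | _⟩ := z <;> simp [residualSign, outcome]
    norm_num
  have hs : Measurable fun z => g z * residualSign z :=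
    hg.mul (((measurable_outcome.comp measurable_snd).const_mul 2).const_sub 1)
  have hint : ∀ μ : Measure Pred, IsFiniteMeasure μ → Integrable (fun z => g z * residual z) μ :=
    fun μ _ => integrable_of_abs_le μ hgr hgr1
  have h1 : ∫ z in Prod.fst ⁻¹' B, residual z ∂recalibrate D =
      ∫ z, g z * residual z ∂recalibrate D := by
    rw [← integral_indicator hB']
    refine integral_congr_ae (ae_of_all _ fun z => ?_)
    by_cases hz : z ∈ (Prod.fst ⁻¹' B : Set Pred) <;> simp [g, hz]
  rw [h1, recalibrate, integral_add_measure (hint _ inferInstance) (hint _ inferInstance),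
    integral_map measurable_flip.aemeasurable hgr.aestronglyMeasurable]
  simp only [hgf, residual_flip, mul_sub]
  rw [integral_sub (hint _ inferInstance) (integrable_of_abs_le _ hs hs1),
    integral_mul_residualSign, ← add_sub_assoc,
    ← integral_add_measure (hint _ inferInstance) (hint _ inferInstance),
    Measure.sub_add_cancel_of_le (flipMass_le D), sub_self]

/-- A plan `ρ` on pairs of predictions `(u, v)`, whose marginals placed on the labels `0` and `1`
fit into the flipped mass, is turned into a coupling of `D` with its recalibration: instead of
flipping the labels of `(u, 0)` and `(v, 1)`, the two predictions are exchanged. -/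
theorem wasserstein_recalibrate_le (d : I → I → ℝ≥0∞) (hd : IsExtMetric d)
    (hdm : Measurable fun p : I × I => d p.1 p.2) (D : Measure Pred) [IsFiniteMeasure D]
    {ρ : Measure (I × I)} [IsFiniteMeasure ρ] {τ : Measure Pred}
    (hτ : τ + (ρ.map (fun p => (p.1, false)) + ρ.map (fun p => (p.2, true))) = flipMass D) :
    wasserstein (predDist d) D (recalibrate D) ≤
      τ Set.univ + 2 * ∫⁻ p, d p.1 p.2 ∂ρ := by
  have ma : Measurable fun p : I × I => ((p.1, false) : Pred) := by fun_prop
  have mb : Measurable fun p : I × I => ((p.2, true) : Pred) := by fun_prop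
  have ma' : Measurable fun p : I × I => ((p.1, true) : Pred) := by fun_prop
  have mb' : Measurable fun p : I × I => ((p.2, false) : Pred) := by fun_prop
  have mδ : Measurable fun z : Pred => (z, z) := by fun_prop
  have mφ : Measurable fun z : Pred => (z, flip z) := measurable_id.prodMk measurable_flip
  have m1 : Measurable fun p : I × I => (((p.1, false), (p.2, false)) : Pred × Pred) :=
    ma.prodMk mb'
  have m2 : Measurable fun p : I × I => (((p.2, true), (p.1, true)) : Pred × Pred) :=
    mb.prodMk ma'
  have mpd : Measurable fun p : Pred × Pred => predDist d p.1 p.2 := by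
    refine (hdm.comp ((measurable_fst.comp measurable_fst).prodMk
      (measurable_fst.comp measurable_snd))).add (ENNReal.measurable_ofReal.comp ?_)
    exact ((measurable_outcome.comp (measurable_snd.comp measurable_fst)).sub
      (measurable_outcome.comp (measurable_snd.comp measurable_snd))).abs
  let γ : Measure (Pred × Pred) := (D - flipMass D).map (fun z => (z, z)) +
    (τ.map (fun z => (z, flip z)) + (ρ.map (fun p => ((p.1, false), (p.2, false))) +
      ρ.map (fun p => ((p.2, true), (p.1, true)))))
  have hγ : IsCoupling D (recalibrate D) γ := by
    refine ⟨?_, ?_⟩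
    · rw [Measure.map_add _ _ measurable_fst, Measure.map_add _ _ measurable_fst,
        Measure.map_add _ _ measurable_fst, Measure.map_map measurable_fst mδ,
        Measure.map_map measurable_fst mφ, Measure.map_map measurable_fst m1,
        Measure.map_map measurable_fst m2]
      simp only [Function.comp_def, Measure.map_id']
      rw [hτ, Measure.sub_add_cancel_of_le (flipMass_le D)]
    · rw [Measure.map_add _ _ measurable_snd, Measure.map_add _ _ measurable_snd,
        Measure.map_add _ _ measurable_snd, Measure.map_map measurable_snd mδ,
        Measure.map_map measurable_snd mφ, Measure.map_map measurable_snd m1,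
        Measure.map_map measurable_snd m2]
      conv_rhs => rw [recalibrate]; arg 2; rw [← hτ]
      rw [Measure.map_add _ _ measurable_flip, Measure.map_add _ _ measurable_flip,
        Measure.map_map measurable_flip ma, Measure.map_map measurable_flip mb]
      simp only [Function.comp_def, Measure.map_id', flip, Bool.not_false, Bool.not_true]
      rw [add_comm (ρ.map _) (ρ.map _)]
      rfl
  refine (iInf₂_le γ hγ).trans ?_
  · rw [lintegral_add_measure, lintegral_add_measure, lintegral_add_measure,
      lintegral_map mpd mδ, lintegral_map mpd mφ, lintegral_map mpd m1, lintegral_map mpd m2]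
    have hself : ∀ u, d u u = 0 := fun u => (hd.eq_zero_iff u u).2 rfl
    have h1 : ∀ z : Pred, predDist d z (flip z) = 1 := fun z => by
      obtain ⟨x, _ | _⟩ := z <;> simp [predDist, flip, outcome, hself]
    have h2 : ∀ p : I × I, d p.2 p.1 = d p.1 p.2 := fun p => hd.symm _ _
    simp only [h1]
    simp only [predDist, hself, sub_self, abs_zero, ENNReal.ofReal_zero, add_zero,
      lintegral_zero, zero_add, lintegral_const, one_mul, h2]
    rw [two_mul]

/-! ### The two inequalities -/

theorem abs_residual_mul_le {w : I → ℝ} (hw : ∀ u, w u ∈ Set.Icc (-1 : ℝ) 1) (z : Pred) :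
    |residual z * w z.1| ≤ 1 := by
  rw [abs_mul]
  exact mul_le_one₀ (abs_residual_le_one z) (abs_nonneg _) (abs_le.2 (hw z.1))

theorem measurable_residual_mul {w : I → ℝ} (hw : Measurable w) :
    Measurable fun z : Pred => residual z * w z.1 :=
  measurable_residual.mul (hw.comp measurable_fst)

theorem le_wCE (d : I → I → ℝ≥0∞) (D : Measure Pred) [IsProbabilityMeasure D] {w : I → ℝ}
    (hw : w ∈ lipschitzTests d) : ∫ z, residual z * w z.1 ∂D ≤ wCE d D := by
  refine le_csSup ⟨1, ?_⟩ ⟨w, hw, rfl⟩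
  rintro _ ⟨w, hw, rfl⟩
  have := norm_integral_le_of_norm_le_const (μ := D) (f := fun z => residual z * w z.1) (C := 1)
    (ae_of_all _ (abs_residual_mul_le hw.2.1))
  rw [probReal_univ, mul_one] at this
  exact (le_abs_self _).trans this

/-- The metric `d` truncated at `2`, the largest distance between two values in `[-1, 1]`. -/
noncomputable def truncDist (d : I → I → ℝ≥0∞) (u v : I) : ℝ := (min (d u v) 2).toReal

section TruncDist

variable {d : I → I → ℝ≥0∞}

theorem min_two_ne_top (x : ℝ≥0∞) : min x 2 ≠ ⊤ :=
  ((min_le_right x 2).trans_lt ENNReal.ofNat_lt_top).ne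

theorem ofReal_truncDist (u v : I) : ENNReal.ofReal (truncDist d u v) = min (d u v) 2 :=
  ENNReal.ofReal_toReal (min_two_ne_top _)

theorem truncDist_nonneg (u v : I) : 0 ≤ truncDist d u v := ENNReal.toReal_nonneg

theorem truncDist_le_two (u v : I) : truncDist d u v ≤ 2 := by
  have := ENNReal.toReal_mono ENNReal.ofNat_ne_top (min_le_right (d u v) 2)
  simpa [truncDist] using this

theorem truncDist_of_two_le {u v : I} (h : 2 ≤ d u v) : truncDist d u v = 2 := by
  simp [truncDist, min_eq_right h]

theorem measurable_truncDist (hdm : Measurable fun p : I × I => d p.1 p.2) :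
    Measurable fun p : I × I => truncDist d p.1 p.2 :=
  (hdm.min measurable_const).ennreal_toReal

theorem truncDist_self (hd : IsExtMetric d) (u : I) : truncDist d u u = 0 := by
  simp [truncDist, (hd.eq_zero_iff u u).2 rfl]

theorem truncDist_comm (hd : IsExtMetric d) (u v : I) : truncDist d u v = truncDist d v u := by
  rw [truncDist, hd.symm, truncDist]

theorem truncDist_triangle (hd : IsExtMetric d) (u v w : I) :
    truncDist d u w ≤ truncDist d u v + truncDist d v w := by
  unfold truncDist
  rw [← ENNReal.toReal_add (min_two_ne_top _) (min_two_ne_top _)]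
  refine ENNReal.toReal_mono (ENNReal.add_ne_top.2 ⟨min_two_ne_top _, min_two_ne_top _⟩) ?_
  rcases le_total (d u v) 2 with h1 | h1
  · rcases le_total (d v w) 2 with h2 | h2
    · rw [min_eq_left h1, min_eq_left h2]
      exact (min_le_left _ _).trans (hd.triangle u v w)
    · rw [min_eq_right h2]
      exact (min_le_right _ _).trans le_add_self
  · rw [min_eq_right h1]
    exact (min_le_right _ _).trans le_self_add

/-- A cover for the reward `2 - d` costs at least the flipped mass minus the weak calibration
error: it dominates a pair of dual potentials, hence a Lipschitz test. -/
theorem flipMass_sub_wCE_le (hd : IsExtMetric d) (hdm : Measurable fun p : I × I => d p.1 p.2)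
    (D : Measure Pred) [IsProbabilityMeasure D] {Φ : Pred → ℝ} (hΦ : Measurable Φ)
    (h0 : ∀ z, 0 ≤ Φ z) (h2 : ∀ z, Φ z ≤ 2)
    (hcov : ∀ u v, 2 - truncDist d u v ≤ Φ (u, false) + Φ (v, true)) :
    (flipMass D).real Set.univ - wCE d D ≤ ∫ z, Φ z ∂flipMass D := by
  obtain ⟨w, hwm, hw, hlip⟩ := exists_measurable_lipschitz_between (e := truncDist d)
    (u := fun x => Φ (x, true) - 1) (v := fun x => Φ (x, false) - 1) (b := 1)
    (measurable_truncDist hdm) truncDist_nonneg (truncDist_self hd) (truncDist_comm hd)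
    (truncDist_triangle hd) (by fun_prop) (by fun_prop)
    (fun x => abs_le.2 ⟨by linarith [h0 (x, true)], by linarith [h2 (x, true)]⟩)
    (fun x => abs_le.2 ⟨by linarith [h0 (x, false)], by linarith [h2 (x, false)]⟩)
    (fun x y => by linarith [hcov x y])
  have hw1 : ∀ u, w u ∈ Set.Icc (-1 : ℝ) 1 := fun u =>
    ⟨by linarith [(hw u).1, h2 (u, false)], by linarith [(hw u).2, h2 (u, true)]⟩
  have hwl : w ∈ lipschitzTests d := by
    refine ⟨hwm, hw1, fun u v => ?_⟩
    have h3 : |w u - w v| ≤ truncDist d u v := by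
      refine abs_sub_le_iff.2 ⟨by linarith [hlip u v], ?_⟩
      rw [truncDist_comm hd]
      linarith [hlip v u]
    refine (ENNReal.ofReal_le_ofReal h3).trans ?_
    rw [ofReal_truncDist]
    exact min_le_left _ _
  have h3 := le_wCE d D hwl
  simp only [mul_comm (residual _)] at h3
  rw [← integral_mul_residualSign D (fun z => w z.1)] at h3
  have hΦi : Integrable Φ (flipMass D) :=
    integrable_of_abs_le (b := 2) _ hΦ fun z => abs_le.2 ⟨by linarith [h0 z], h2 z⟩
  have hwi : Integrable (fun z => w z.1 * residualSign z) (flipMass D) := by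
    refine integrable_of_abs_le (b := 1) _ ((hwm.comp measurable_fst).mul
      (((measurable_outcome.comp measurable_snd).const_mul 2).const_sub 1)) fun z => ?_
    obtain ⟨x, _ | _⟩ := z <;> simp only [residualSign, outcome] <;> norm_num <;>
      exact abs_le.2 (hw1 x)
  have h4 : ∫ z, (1 - Φ z) ∂flipMass D ≤ ∫ z, w z.1 * residualSign z ∂flipMass D := by
    refine integral_mono ((integrable_const 1).sub hΦi) hwi fun z => ?_
    obtain ⟨x, _ | _⟩ := z <;> simp only [residualSign, outcome] <;> norm_num
    · linarith [(hw x).1]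
    · linarith [(hw x).2]
  rw [integral_sub (integrable_const 1) hΦi, integral_const, smul_eq_mul, mul_one] at h4
  linarith

/-- Duality: there is a partial transport plan between the label-`0` and the label-`1` part of the
flipped mass whose reward `∫ (2 - d)` nearly reaches the dual bound. Pairs at distance at
least `2` earn no reward and are left untransported. -/
theorem exists_plan (hd : IsExtMetric d) (hdm : Measurable fun p : I × I => d p.1 p.2)
    (D : Measure Pred) [IsProbabilityMeasure D] {s : ℝ}
    (hs : s < (flipMass D).real Set.univ - wCE d D) :
    ∃ ρ : Measure (I × I), IsFiniteMeasure ρ ∧ (∀ᵐ p ∂ρ, d p.1 p.2 < 2) ∧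
      ρ.map (fun p => ((p.1, false) : Pred)) + ρ.map (fun p => ((p.2, true) : Pred)) ≤ flipMass D ∧
      s ≤ ∫ p, (2 - truncDist d p.1 p.2) ∂ρ := by
  have hem := measurable_truncDist hdm
  -- the subgraph of the reward is a continuous image of the Baire space
  let A : Set (I × I × ℝ) := {q | 0 ≤ q.2.2 ∧ q.2.2 ≤ 2 - truncDist d q.1 q.2.1}
  have hA : MeasurableSet A := by
    refine (measurableSet_le measurable_const (measurable_snd.comp measurable_snd)).inter
      (measurableSet_le (measurable_snd.comp measurable_snd) (Measurable.const_sub ?_ 2))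
    exact hem.comp (measurable_fst.prodMk (measurable_fst.comp measurable_snd))
  have hA0 : ∀ u v, (u, v, 2 - truncDist d u v) ∈ A := fun u v =>
    ⟨by simpa using truncDist_le_two u v, le_rfl⟩
  have hAan := hA.analyticSet
  rw [AnalyticSet] at hAan
  rcases hAan with hA' | ⟨F, hF, hFA⟩
  · exact absurd (hA0 0 0) (by simp [hA'])
  have hFm : ∀ z, F z ∈ A := fun z => hFA ▸ Set.mem_range_self z
  obtain ⟨ρ, hρ, hle, hsρ⟩ := exists_measure_of_forall_isCover (flipMass D)
    (α := fun z => ((F z).1, false)) (β := fun z => ((F z).2.1, true))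
    (c := fun z => (F z).2.2) (M := 2) (s := s) (by fun_prop) (by fun_prop) (by fun_prop)
    (fun z => (hFm z).1)
    (fun z => (hFm z).2.trans (by linarith [truncDist_nonneg (d := d) (F z).1 (F z).2.1]))
    (fun Φ hΦ => hs.trans_le (flipMass_sub_wCE_le hd hdm D hΦ.measurable hΦ.nonneg hΦ.le
      fun u v => by
        obtain ⟨z, hz⟩ : (u, v, 2 - truncDist d u v) ∈ Set.range F := hFA ▸ hA0 u v
        simpa [hz] using hΦ.cover z (Set.mem_univ z)))
  have hG : Measurable fun z => ((F z).1, (F z).2.1) := by fun_prop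
  have ma : Measurable fun p : I × I => ((p.1, false) : Pred) := by fun_prop
  have mb : Measurable fun p : I × I => ((p.2, true) : Pred) := by fun_prop
  have hS : MeasurableSet {p : I × I | d p.1 p.2 < 2} := measurableSet_lt hdm measurable_const
  refine ⟨(ρ.map fun z => ((F z).1, (F z).2.1)).restrict {p | d p.1 p.2 < 2}, inferInstance,
    ae_restrict_mem hS, ?_, ?_⟩
  · refine (add_le_add (Measure.map_mono Measure.restrict_le_self ma)
      (Measure.map_mono Measure.restrict_le_self mb)).trans ?_
    rw [Measure.map_map ma hG, Measure.map_map mb hG]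
    exact hle
  · have hrm : Measurable fun p : I × I => 2 - truncDist d p.1 p.2 := hem.const_sub 2
    rw [setIntegral_eq_integral_of_forall_compl_eq_zero fun p hp => by
      rw [truncDist_of_two_le (not_lt.1 hp), sub_self],
      integral_map hG.aemeasurable hrm.aestronglyMeasurable]
    refine hsρ.trans (integral_mono ?_ ?_ fun z => (hFm z).2)
    · refine integrable_of_abs_le (b := 2) _ (by fun_prop) fun z => ?_
      have h1 := hFm z
      have h2 := truncDist_nonneg (d := d) (F z).1 (F z).2.1
      exact abs_le.2 ⟨by linarith [h1.1], by linarith [h1.2]⟩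
    · refine integrable_of_abs_le (b := 2) _ (hrm.comp hG) fun z => ?_
      have h1 := truncDist_nonneg (d := d) (F z).1 (F z).2.1
      have h2 := truncDist_le_two (d := d) (F z).1 (F z).2.1
      exact abs_le.2 ⟨by simp only; linarith, by simp only; linarith⟩

theorem dCE_le (hd : IsExtMetric d) (hdm : Measurable fun p : I × I => d p.1 p.2)
    (D : Measure Pred) [IsProbabilityMeasure D] : dCE d D ≤ ENNReal.ofReal (2 * wCE d D) := by
  have key : ∀ ε : ℝ, 0 < ε → dCE d D ≤ ENNReal.ofReal (2 * (wCE d D + ε)) := by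
    intro ε hε
    obtain ⟨ρ, hρ, hlt, hle, hs⟩ := exists_plan hd hdm D
      (s := (flipMass D).real Set.univ - wCE d D - ε) (by linarith)
    have ma : Measurable fun p : I × I => ((p.1, false) : Pred) := by fun_prop
    have mb : Measurable fun p : I × I => ((p.2, true) : Pred) := by fun_prop
    set τ := flipMass D - (ρ.map (fun p => ((p.1, false) : Pred)) +
      ρ.map (fun p => ((p.2, true) : Pred))) with hτdef
    have hτ : τ + (ρ.map (fun p => (p.1, false)) + ρ.map (fun p => (p.2, true))) = flipMass D :=
      Measure.sub_add_cancel_of_le hle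
    have hprob : IsProbabilityMeasure (recalibrate D) := by
      constructor
      rw [recalibrate, Measure.add_apply, Measure.map_apply measurable_flip MeasurableSet.univ,
        Set.preimage_univ, ← Measure.add_apply, Measure.sub_add_cancel_of_le (flipMass_le D)]
      exact measure_univ
    have hmass : τ.real Set.univ + 2 * ρ.real Set.univ = (flipMass D).real Set.univ := by
      rw [← hτ, measureReal_add_apply, measureReal_add_apply,
        map_measureReal_apply ma MeasurableSet.univ, map_measureReal_apply mb MeasurableSet.univ,
        Set.preimage_univ, Set.preimage_univ, two_mul]
    have hei : Integrable (fun p : I × I => truncDist d p.1 p.2) ρ :=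
      integrable_of_abs_le (b := 2) _ (measurable_truncDist hdm) fun p => by
        rw [abs_of_nonneg (truncDist_nonneg _ _)]
        exact truncDist_le_two _ _
    have hcost : ∫⁻ p, d p.1 p.2 ∂ρ = ENNReal.ofReal (∫ p, truncDist d p.1 p.2 ∂ρ) := by
      rw [ofReal_integral_eq_lintegral_ofReal hei (ae_of_all _ fun p => truncDist_nonneg _ _)]
      refine lintegral_congr_ae ?_
      filter_upwards [hlt] with p hp
      rw [ofReal_truncDist, min_eq_left hp.le]
    refine (iInf_le_of_le (recalibrate D) (iInf₂_le hprob
      (isPerfectlyCalibrated_recalibrate D))).trans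
      ((wasserstein_recalibrate_le d hd hdm D hτ).trans ?_)
    have he0 : 0 ≤ ∫ p, truncDist d p.1 p.2 ∂ρ := integral_nonneg fun p => truncDist_nonneg _ _
    rw [hcost, ← ofReal_measureReal, ← ENNReal.ofReal_ofNat, ← ENNReal.ofReal_mul zero_le_two,
      ← ENNReal.ofReal_add measureReal_nonneg (by positivity)]
    refine ENNReal.ofReal_le_ofReal ?_
    rw [integral_sub (integrable_const 2) hei, integral_const, smul_eq_mul] at hs
    have := measureReal_nonneg (μ := τ) (s := Set.univ)
    linarith
  have hlim : Tendsto (fun ε : ℝ => ENNReal.ofReal (2 * (wCE d D + ε))) (𝓝[>] 0)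
      (𝓝 (ENNReal.ofReal (2 * (wCE d D + 0)))) :=
    ((ENNReal.continuous_ofReal.comp
      (by fun_prop : Continuous fun ε : ℝ => 2 * (wCE d D + ε))).tendsto 0).mono_left nhdsWithin_le_nhds
  have := ge_of_tendsto hlim (eventually_nhdsWithin_of_forall key)
  rwa [add_zero] at this

end TruncDist

/-- A calibrated distribution passes every test that depends on the prediction only. -/
theorem IsPerfectlyCalibrated.integral_residual_mul_eq_zero {D : Measure Pred} [IsFiniteMeasure D]
    (hD : IsPerfectlyCalibrated D) {w : I → ℝ} (hw : Measurable w)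
    (hw1 : ∀ u, w u ∈ Set.Icc (-1 : ℝ) 1) : ∫ z, residual z * w z.1 ∂D = 0 := by
  have hm : MeasurableSpace.comap (Prod.fst : Pred → I) inferInstance ≤
      (inferInstance : MeasurableSpace Pred) := measurable_fst.comap_le
  have hwz : ∀ z : Pred, |w z.1| ≤ 1 := fun z => abs_le.2 (hw1 z.1)
  have hf : Measurable fun z : Pred => (z.1 : ℝ) := measurable_subtype_coe.comp measurable_fst
  have hy : Measurable fun z : Pred => outcome z.2 := measurable_outcome.comp measurable_snd
  have hf1 : ∀ z : Pred, |(z.1 : ℝ)| ≤ 1 := fun z =>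
    abs_le.2 ⟨by linarith [z.1.2.1], z.1.2.2⟩
  have hy1 : ∀ z : Pred, |outcome z.2| ≤ 1 := fun z => by
    obtain ⟨x, _ | _⟩ := z <;> simp [outcome]
  have hprod : ∀ f : Pred → ℝ, Measurable f → (∀ z, |f z| ≤ 1) →
      Integrable (fun z => w z.1 * f z) D := fun f hfm hfb =>
    integrable_of_abs_le (b := 1) D ((hw.comp measurable_fst).mul hfm) fun z => by
      rw [abs_mul]
      exact mul_le_one₀ (hwz z) (abs_nonneg _) (hfb z)
  have h1 : ∫ z, w z.1 * outcome z.2 ∂D = ∫ z, w z.1 * (z.1 : ℝ) ∂D := by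
    have h2 := condExp_mul_of_stronglyMeasurable_left (μ := D)
      (f := fun z : Pred => w z.1) (g := fun z : Pred => outcome z.2)
      (hw.comp (comap_measurable (Prod.fst : Pred → I))).stronglyMeasurable
      (hprod _ hy hy1) (integrable_of_abs_le D hy hy1)
    have h3 := integral_condExp (μ := D) (f := (fun z : Pred => w z.1) * fun z => outcome z.2) hm
    simp only [Pi.mul_apply] at h3
    rw [← h3]
    refine integral_congr_ae ?_
    filter_upwards [h2, hD] with z h4 h5
    rw [h4, Pi.mul_apply, h5]
  have h2 : ∀ z : Pred, residual z * w z.1 = w z.1 * (z.1 : ℝ) - w z.1 * outcome z.2 := fun z => by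
    rw [residual]
    ring
  simp only [h2]
  rw [integral_sub (hprod _ hf hf1) (hprod _ hy hy1), h1, sub_self]

/-- The tested residual `(f - y) w(f)` is Lipschitz for `predDist d`. -/
theorem ofReal_abs_sub_le_predDist {c : ℝ} (hc : 0 < c) {d : I → I → ℝ≥0∞}
    (hcd : ∀ u v : I, ENNReal.ofReal (c * |(u : ℝ) - (v : ℝ)|) ≤ d u v) {w : I → ℝ}
    (hw : w ∈ lipschitzTests d) (p q : Pred) :
    ENNReal.ofReal |residual p * w p.1 - residual q * w q.1| ≤
      ((1 + Real.toNNReal c⁻¹ : ℝ≥0) : ℝ≥0∞) * predDist d p q := by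
  have h1 : |residual p * w p.1 - residual q * w q.1| ≤
      |w p.1 - w q.1| + (c⁻¹ * (c * |(p.1 : ℝ) - q.1|) + |outcome p.2 - outcome q.2|) := by
    rw [inv_mul_cancel_left₀ hc.ne']
    have h2 : residual p * w p.1 - residual q * w q.1 =
        residual p * (w p.1 - w q.1) +
          (((p.1 : ℝ) - q.1) - (outcome p.2 - outcome q.2)) * w q.1 := by
      simp only [residual]
      ring
    rw [h2]
    refine (abs_add_le _ _).trans (add_le_add ?_ ?_)
    · rw [abs_mul]
      exact mul_le_of_le_one_left (abs_nonneg _) (abs_residual_le_one p)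
    · rw [abs_mul]
      exact (mul_le_of_le_one_right (abs_nonneg _) (abs_le.2 (hw.2.1 q.1))).trans (abs_sub _ _)
  refine (ENNReal.ofReal_le_ofReal h1).trans ?_
  rw [ENNReal.ofReal_add (abs_nonneg _) (by positivity),
    ENNReal.ofReal_add (by positivity) (abs_nonneg _), ENNReal.ofReal_mul (inv_pos.2 hc).le,
    predDist, ENNReal.coe_add, ENNReal.coe_one, mul_add, add_mul, one_mul, ← add_assoc]
  refine add_le_add (add_le_add (hw.2.2 _ _) ?_) ?_
  · exact mul_le_mul_right (hcd _ _) _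
  · exact le_mul_of_one_le_left (zero_le) le_self_add

theorem ofReal_wCE_le {c : ℝ} (hc : 0 < c) {d : I → I → ℝ≥0∞}
    (hcd : ∀ u v : I, ENNReal.ofReal (c * |(u : ℝ) - (v : ℝ)|) ≤ d u v) (D : Measure Pred)
    [IsProbabilityMeasure D] :
    ENNReal.ofReal (wCE d D) ≤ ((1 + Real.toNNReal c⁻¹ : ℝ≥0) : ℝ≥0∞) * dCE d D := by
  have hC : ((1 + Real.toNNReal c⁻¹ : ℝ≥0) : ℝ≥0∞) ≠ 0 := by
    rw [ENNReal.coe_ne_zero]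
    positivity
  have key : ∀ w ∈ lipschitzTests d, ENNReal.ofReal (∫ z, residual z * w z.1 ∂D) ≤
      ((1 + Real.toNNReal c⁻¹ : ℝ≥0) : ℝ≥0∞) * dCE d D := by
    intro w hw
    rw [← ENNReal.div_le_iff' hC ENNReal.coe_ne_top]
    refine le_iInf fun D' => le_iInf₂ fun hprob hcal => le_iInf₂ fun γ hγ => ?_
    rw [ENNReal.div_le_iff' hC ENNReal.coe_ne_top]
    have hγf : IsFiniteMeasure γ := by
      constructor
      have := congrArg (fun μ => μ Set.univ) hγ.1
      simp only [Measure.map_apply measurable_fst MeasurableSet.univ, Set.preimage_univ,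
        measure_univ] at this
      simp [this]
    have hm := measurable_residual_mul hw.1
    have hb := abs_residual_mul_le hw.2.1
    have hi₁ : Integrable (fun p : Pred × Pred => residual p.1 * w p.1.1) γ :=
      integrable_of_abs_le γ (hm.comp measurable_fst) fun p => hb p.1
    have hi₂ : Integrable (fun p : Pred × Pred => residual p.2 * w p.2.1) γ :=
      integrable_of_abs_le γ (hm.comp measurable_snd) fun p => hb p.2
    have h1 : ∫ z, residual z * w z.1 ∂D =
        ∫ p, (residual p.1 * w p.1.1 - residual p.2 * w p.2.1) ∂γ := by
      rw [integral_sub hi₁ hi₂]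
      have h2 := hcal.integral_residual_mul_eq_zero hw.1 hw.2.1
      rw [← hγ.2, integral_map measurable_snd.aemeasurable hm.aestronglyMeasurable] at h2
      rw [h2, sub_zero, ← hγ.1,
        integral_map measurable_fst.aemeasurable hm.aestronglyMeasurable]
    rw [h1]
    calc ENNReal.ofReal (∫ p, (residual p.1 * w p.1.1 - residual p.2 * w p.2.1) ∂γ)
        ≤ ENNReal.ofReal (∫ p, |residual p.1 * w p.1.1 - residual p.2 * w p.2.1| ∂γ) :=
          ENNReal.ofReal_le_ofReal ((le_abs_self _).trans abs_integral_le_integral_abs)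
      _ = ∫⁻ p, ENNReal.ofReal |residual p.1 * w p.1.1 - residual p.2 * w p.2.1| ∂γ :=
          ofReal_integral_eq_lintegral_ofReal (hi₁.sub hi₂).abs (ae_of_all _ fun p => abs_nonneg _)
      _ ≤ ∫⁻ p, ((1 + Real.toNNReal c⁻¹ : ℝ≥0) : ℝ≥0∞) * predDist d p.1 p.2 ∂γ :=
          lintegral_mono fun p => ofReal_abs_sub_le_predDist hc hcd hw p.1 p.2
      _ = _ := lintegral_const_mul' _ _ ENNReal.coe_ne_top
  rcases eq_or_ne (((1 + Real.toNNReal c⁻¹ : ℝ≥0) : ℝ≥0∞) * dCE d D) ⊤ with htop | htop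
  · rw [htop]
    exact le_top
  · refine ENNReal.ofReal_le_of_le_toReal (csSup_le ⟨_, 0, ?_, rfl⟩ ?_)
    · exact ⟨measurable_zero, fun u => by simp, fun u v => by simp⟩
    · rintro _ ⟨w, hw, rfl⟩
      exact (ENNReal.ofReal_le_iff_le_toReal htop).1 (key w hw)

end Calibration

theorem mainTheorem2 (c : ℝ) (hc : 0 < c) :
    ∃ C₁ C₂ : ℝ≥0, 0 < C₁ ∧ 0 < C₂ ∧
      ∀ d : I → I → ℝ≥0∞, Calibration.IsExtMetric d →
        Measurable (fun p : I × I => d p.1 p.2) →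
        (∀ u v : I, ENNReal.ofReal (c * |(u : ℝ) - (v : ℝ)|) ≤ d u v) →
        ∀ D : Measure Calibration.Pred, IsProbabilityMeasure D →
          (C₁ : ℝ≥0∞) * Calibration.dCE d D ≤ ENNReal.ofReal (Calibration.wCE d D) ∧
          ENNReal.ofReal (Calibration.wCE d D) ≤ (C₂ : ℝ≥0∞) * Calibration.dCE d D := by
  refine ⟨2⁻¹, 1 + Real.toNNReal c⁻¹, by positivity, by positivity,
    fun d hd hdm hcd D _ => ⟨?_, Calibration.ofReal_wCE_le hc hcd D⟩⟩
  have h := Calibration.dCE_le hd hdm D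
  rw [ENNReal.ofReal_mul zero_le_two, ENNReal.ofReal_ofNat] at h
  rw [ENNReal.coe_inv two_ne_zero, ENNReal.coe_ofNat, mul_comm, ← div_eq_mul_inv]
  exact ENNReal.div_le_of_le_mul' h
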